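/- Let $\mathbb F_r\subseteq\mathbb F_q$ be finite fields and let $F=\mathbb F_q(\mathcal X)$ be the function field of an absolutely irreducible nonsingular algebraic curve $\mathcal X$ over $\mathbb F_q$ (an algebraic function field of one variable with full constant field $\mathbb F_q$). Let $D=P_1+\cdots+P_n$ be the sum of $n$ distinct places of degree one, and let $G\ge 0$ be an effective divisor with $P_i\notin\operatorname{supp}G$ for all $i$. For an integer $s$ let $$\mathscr L(sG)=\{f\in F\setminus\{0\}\mid (f)\ge -sG\}\cup\{0\},\qquad C_L(D,sG)=\{(f(P_1),\dots,f(P_n))\mid f\in\mathscr L(sG)\}\subseteq\mathbb F_q^n,$$ let $C_L(D,sG)|_{\mathbb F_r}=C_L(D,sG)\cap\mathbb F_r^n$ be the subfield subcode, and let $R(s)=\frac1n\dim_{\mathbb F_r}C_L(D,sG)|_{\mathbb F_r}$ be its rate. Extend $R$ to real arguments by $R(x)=R(\lfloor x\rfloor)$. Then for every real $x\ge 0$ with $x\cdot r\deg G<n$ (that is, $0\le x<n/(r\deg G)$ when $\deg G>0$), the code $C_L(D,\lfloor x\rfloor G)|_{\mathbb F_r}$ consists exactly of the constant vectors $(a,\dots,a)$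 with $a\in\mathbb F_r$, and $R(x)=1/n$. -/

import Mathlib

open scoped WithZero

/-- `K / F` is an algebraic function field of one variable with full constant field `F`: `K` is a
finite extension of `F(x)` for some `x` transcendental over `F`, and `F` is algebraically closed
in `K`. Over a finite (hence perfect) field `F`, these are exactly the function fields of the
absolutely irreducible nonsingular (projective) curves over `F`. -/
structure IsCurveFunctionField (F K : Type*) [Field F] [Field K] [Algebra F K] : Prop where
  exists_finite : ∃ x : K, Transcendental F x ∧
    FiniteDimensional (IntermediateField.adjoin F ({x} : Set K)) K
  full_constants : ∀ z : K, IsAlgebraic F z → z ∈ (algebraMap F K).range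

/-- A place of `K / F`, given by its valuation ring: a discrete valuation ring of `K`, with field
of fractions `K`, that contains `F`. -/
structure Place (F K : Type*) [Field F] [Field K] [Algebra F K] where
  ring : ValuationSubring K
  algebraMap_mem : ∀ a : F, algebraMap F K a ∈ ring
  isDVR : IsDiscreteValuationRing ring

namespace Place

variable {F K : Type*} [Field F] [Field K] [Algebra F K] (P : Place F K)

instance : IsDiscreteValuationRing P.ring := P.isDVR

/-- The inclusion of the constants in the valuation ring of a place. -/
noncomputable def constants : F →+* P.ring where
  toFun a := ⟨algebraMap F K a, P.algebraMap_mem a⟩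
  map_one' := Subtype.ext (map_one _)
  map_mul' a b := Subtype.ext (map_mul _ a b)
  map_zero' := Subtype.ext (map_zero _)
  map_add' a b := Subtype.ext (map_add _ a b)

/-- The residue field of a place. -/
abbrev Residue : Type _ := IsLocalRing.ResidueField P.ring

/-- The residue field of a place is an extension of the field of constants. -/
noncomputable instance : Algebra F P.Residue :=
  ((IsLocalRing.residue P.ring).comp P.constants).toAlgebra

/-- The degree of a place: the degree of its residue field over the field of constants. -/
noncomputable def degree : ℕ := Module.finrank F P.Residue

/-- The normalized discrete valuation of a place, in multiplicative form. -/
noncomputable def valuation : Valuation K ℤᵐ⁰ :=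
  (IsDiscreteValuationRing.maximalIdeal P.ring).valuation K

/-- The order of a function at a place (with the value `0` at the zero function). -/
noncomputable def ord (f : K) : ℤ := -WithZero.log (P.valuation f)

/-- `P.HasValue f a` says that `f` is regular at `P` and that `f(P) = a`, that is, the residue
class of `f` at `P` is the constant `a`. (At a place of degree one every regular function has
exactly one value in `F`.) -/
def HasValue (f : K) (a : F) : Prop :=
  ∃ hf : f ∈ P.ring, IsLocalRing.residue P.ring ⟨f, hf⟩ = algebraMap F P.Residue a

theorem valuation_algebraMap_le_one (a : F) : P.valuation (algebraMap F K a) ≤ 1 :=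
  (IsDiscreteValuationRing.maximalIdeal P.ring).valuation_le_one (K := K)
    ⟨algebraMap F K a, P.algebraMap_mem a⟩

theorem neg_le_ord_iff {f : K} (hf : f ≠ 0) (m : ℤ) :
    -m ≤ P.ord f ↔ P.valuation f ≤ WithZero.exp m := by
  have h : P.valuation f ≠ 0 := (Valuation.ne_zero_iff _).2 hf
  rw [ord, neg_le_neg_iff, WithZero.log_le_iff_le_exp h]

theorem HasValue.zero : P.HasValue 0 0 :=
  ⟨P.ring.zero_mem, by rw [map_zero]; exact map_zero (IsLocalRing.residue P.ring)⟩

theorem HasValue.add {f g : K} {a b : F} (hf : P.HasValue f a) (hg : P.HasValue g b) :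
    P.HasValue (f + g) (a + b) := by
  obtain ⟨h1, e1⟩ := hf
  obtain ⟨h2, e2⟩ := hg
  refine ⟨P.ring.add_mem _ _ h1 h2, ?_⟩
  rw [map_add, ← e1, ← e2, ← map_add]
  rfl

theorem HasValue.smul {f : K} {a : F} (c : F) (hf : P.HasValue f a) :
    P.HasValue (c • f) (c * a) := by
  obtain ⟨h1, e1⟩ := hf
  refine ⟨by rw [Algebra.smul_def]; exact P.ring.mul_mem _ _ (P.algebraMap_mem c) h1, ?_⟩
  have h : (⟨c • f, by rw [Algebra.smul_def]
                       exact P.ring.mul_mem _ _ (P.algebraMap_mem c) h1⟩ : P.ring) =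
      P.constants c * ⟨f, h1⟩ := Subtype.ext (Algebra.smul_def c f)
  rw [h, map_mul, map_mul, e1]
  rfl

end Place

/-- Divisors of `K / F`: finite formal integer combinations of places. -/
abbrev FFDivisor (F K : Type*) [Field F] [Field K] [Algebra F K] : Type _ := Place F K →₀ ℤ

/-- The degree of a divisor. -/
noncomputable def FFDivisor.deg {F K : Type*} [Field F] [Field K] [Algebra F K]
    (G : FFDivisor F K) : ℤ :=
  G.sum fun P m => m * (P.degree : ℤ)

/-- The Riemann-Roch space `L(G)`: zero, and the functions `f ≠ 0` with `(f) ≥ -G`. -/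
noncomputable def riemannRochSpace {F K : Type*} [Field F] [Field K] [Algebra F K]
    (G : FFDivisor F K) : Submodule F K where
  carrier := {f | f = 0 ∨ ∀ P : Place F K, -G P ≤ P.ord f}
  zero_mem' := Or.inl rfl
  add_mem' {f g} hf hg := by
    rcases eq_or_ne f 0 with rfl | hf0
    · simpa using hg
    rcases eq_or_ne g 0 with rfl | hg0
    · simpa using hf
    rcases eq_or_ne (f + g) 0 with h0 | h0
    · exact Or.inl h0
    refine Or.inr fun P => ?_
    rw [P.neg_le_ord_iff h0]
    exact P.valuation.map_add_le ((P.neg_le_ord_iff hf0 _).1 (hf.resolve_left hf0 P))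
      ((P.neg_le_ord_iff hg0 _).1 (hg.resolve_left hg0 P))
  smul_mem' c f hf := by
    rcases eq_or_ne (c • f) 0 with h0 | h0
    · exact Or.inl h0
    have hf0 : f ≠ 0 := fun h => h0 (by rw [h, smul_zero])
    refine Or.inr fun P => ?_
    rw [P.neg_le_ord_iff h0, Algebra.smul_def, map_mul]
    exact (mul_le_of_le_one_left' (P.valuation_algebraMap_le_one c)).trans
      ((P.neg_le_ord_iff hf0 _).1 (hf.resolve_left hf0 P))

/-- The functional code `C_L(D, G) = {(f(P₁), …, f(Pₙ)) | f ∈ L(G)}`, for `D = P₁ + ⋯ + Pₙ`. -/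
noncomputable def functionalCode {F K : Type*} [Field F] [Field K] [Algebra F K] {n : ℕ}
    (P : Fin n → Place F K) (G : FFDivisor F K) : Submodule F (Fin n → F) where
  carrier := {c | ∃ f ∈ riemannRochSpace G, ∀ i, (P i).HasValue f (c i)}
  zero_mem' := ⟨0, zero_mem _, fun i => Place.HasValue.zero (P i)⟩
  add_mem' := by
    rintro c d ⟨f, hf, hc⟩ ⟨g, hg, hd⟩
    exact ⟨f + g, add_mem hf hg, fun i => (hc i).add (P i) (hd i)⟩
  smul_mem' := by
    rintro a c ⟨f, hf, hc⟩
    exact ⟨a • f, Submodule.smul_mem _ a hf, fun i => (hc i).smul (P i) a⟩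

/-- The subfield subcode `C ∩ kⁿ` of a linear code `C ⊆ Fⁿ`, a vector space over the subfield `k`
of `F`. -/
def subfieldSubcode {F : Type*} [Field F] (k : Subfield F) {n : ℕ}
    (C : Submodule F (Fin n → F)) : Submodule k (Fin n → F) where
  carrier := {c | c ∈ C ∧ ∀ i, c i ∈ k}
  zero_mem' := ⟨zero_mem C, fun _ => zero_mem k⟩
  add_mem' hc hd := ⟨add_mem hc.1 hd.1, fun i => add_mem (hc.2 i) (hd.2 i)⟩
  smul_mem' a _ hc := ⟨C.smul_mem (a : F) hc.1, fun i => mul_mem a.2 (hc.2 i)⟩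

/-- The rate `R(s) = dim_k (C_L(D, sG)|_k) / n`, for an integer `s`. -/
noncomputable def subcodeRate {F K : Type*} [Field F] [Field K] [Algebra F K] (k : Subfield F)
    {n : ℕ} (P : Fin n → Place F K) (G : FFDivisor F K) (s : ℤ) : ℝ :=
  (Module.finrank k (subfieldSubcode k (functionalCode P (s • G))) : ℝ) / n

/-- The extended rate function `R(x) = R(⌊x⌋)`, for real `x`. -/
noncomputable def extendedRate {F K : Type*} [Field F] [Field K] [Algebra F K] (k : Subfield F)
    {n : ℕ} (P : Fin n → Place F K) (G : FFDivisor F K) (x : ℝ) : ℝ :=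
  subcodeRate k P G ⌊x⌋

open Polynomial
open scoped IntermediateField.algebraAdjoinAdjoin

/-! If `f` has poles bounded by `sG` and takes values in the subfield of order `r` at every `P i`,
then `f ^ r - f` vanishes at all `n` places, while its poles are bounded by `r s G`, of degree less
than `n`. Hence it is zero, `f` is algebraic over `F`, so constant, and the constant is one of its
values. Conversely, constants lie in `L(sG)` because `sG` is effective.

The weight is in `card_zeros_le_deg`: a nonzero `h` has no more rational zeros than the degree of a
divisor bounding its poles. Functions with Kronecker-delta values at `n` zeros of `h` are
independent over `F[h]`. Clearing denominators makes them integral over `F[h]`, say `u i`, and the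
`(t + 1) n` products `h ^ j * u i` with `j ≤ t` lie in `L((t + c) A)`, whose dimension is at most
`(t + c) deg A + 1` (`rank_riemannRochSpace_le`). Large `t` gives `n ≤ deg A`.

The dimension bound starts from `L(0) = F`, that is, from the existence of poles
(`exists_place_notMem`). This needs nontrivial valuation rings over `F` to be discrete, a
consequence of the finiteness of `K` over `F(h)`. -/

section

variable {F K : Type*} [Field F] [Field K] [Algebra F K]

/-! ### Linear independence over `F[h]` -/

/-- A polynomial relation criterion for linear independence over `F[h]`: it suffices that in every
relation all the coefficients vanish at `0`. -/
theorem linearIndependent_adjoin_of_coeff_zero {ι : Type*} [Finite ι] {h : K} (h0 : h ≠ 0)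
    (w : ι → K)
    (H : ∀ p : ι → F[X], ∑ᶠ i, aeval h (p i) * w i = 0 → ∀ i, (p i).coeff 0 = 0) :
    LinearIndependent (Algebra.adjoin F ({h} : Set K)) w := by
  cases nonempty_fintype ι
  simp only [finsum_eq_sum_of_fintype] at H
  -- Once all constant coefficients vanish, cancelling `h` leaves another relation; iterating makes
  -- the coefficients divisible by every power of `X`.
  have key : ∀ m : ℕ, ∀ p : ι → F[X], ∑ i, aeval h (p i) * w i = 0 → ∀ i, X ^ m ∣ p i := by
    intro m
    induction m with
    | zero => intro p _ i; simp
    | succ m ih =>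
      intro p hp
      choose q hq using fun i => X_dvd_iff.2 (H p hp i)
      have hq' : ∑ i, aeval h (q i) * w i = 0 := by
        have : h * ∑ i, aeval h (q i) * w i = 0 := by
          rw [← hp, Finset.mul_sum]
          refine Finset.sum_congr rfl fun i _ => ?_
          rw [hq i, map_mul, aeval_X, mul_assoc]
        exact (mul_eq_zero.1 this).resolve_left h0
      intro i
      rw [hq i, pow_succ']
      exact mul_dvd_mul_left _ (ih q hq' i)
  rw [Fintype.linearIndependent_iff]
  intro g hg i
  have hex : ∀ i, ∃ p : F[X], aeval h p = (g i : K) := fun i => by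
    exact (Algebra.adjoin_singleton_eq_range_aeval F h).le (g i).2
  choose p hp using hex
  have hz : p i = 0 := by
    by_contra hne
    have := key ((p i).natDegree + 1) p (by simpa [hp, Subalgebra.smul_def] using hg) i
    have := natDegree_le_of_dvd this hne
    simp at this
  apply Subtype.ext
  rw [← hp i, hz, map_zero]
  rfl

/-- Since `φ` kills multiples of `h`, it reduces a relation over `F[h]` to one among the `φ (w i)`
with the constant coefficients. It serves for the residue map at one place and for the residues at
several places jointly. -/
theorem linearIndependent_adjoin_of_residue {ι V : Type*} [Finite ι] [AddCommGroup V] [Module F V]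
    {h : K} (h0 : h ≠ 0) (R : Subalgebra F K) (hR : h ∈ R) (φ : R →ₗ[F] V)
    (hφ : ∀ r : R, φ (⟨h, hR⟩ * r) = 0) (w : ι → R) (hw : LinearIndependent F fun i => φ (w i)) :
    LinearIndependent (Algebra.adjoin F ({h} : Set K)) fun i => (w i : K) := by
  cases nonempty_fintype ι
  refine linearIndependent_adjoin_of_coeff_zero h0 _ fun p hp => ?_
  rw [finsum_eq_sum_of_fintype] at hp
  have hsum : ∑ i, aeval (⟨h, hR⟩ : R) (p i) * w i = 0 := by
    apply Subtype.ext
    refine Eq.trans ?_ hp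
    simp only [AddSubmonoidClass.coe_finsetSum, MulMemClass.coe_mul]
    refine Finset.sum_congr rfl fun i _ => ?_
    congr 1
    exact (aeval_algHom_apply R.val (⟨h, hR⟩ : R) (p i)).symm
  refine Fintype.linearIndependent_iff.1 hw _ ?_
  have := congrArg φ hsum
  rw [map_zero, map_sum] at this
  rw [← this]
  refine Finset.sum_congr rfl fun i _ => ?_
  have e : aeval (⟨h, hR⟩ : R) (p i) * w i =
      ⟨h, hR⟩ * (aeval (⟨h, hR⟩ : R) (p i).divX * w i) + (p i).coeff 0 • w i := by
    conv_lhs => rw [← X_mul_divX_add (p i)]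
    rw [map_add, map_mul, aeval_X, aeval_C, add_mul, mul_assoc, Algebra.smul_def]
  rw [e, map_add, hφ, zero_add, map_smul]

/-! ### Finiteness of `K` over `F(h)` -/

/-- The transcendence degree is at most one, so `h` alone is a transcendence basis; `K` is algebraic
and finitely generated over `F(h)`, hence finite. -/
theorem IsCurveFunctionField.finiteDimensional_adjoin (hK : IsCurveFunctionField F K) {h : K}
    (hh : Transcendental F h) :
    FiniteDimensional (IntermediateField.adjoin F ({h} : Set K)) K := by
  obtain ⟨x, hx, hfin⟩ := hK.exists_finite
  have e1 : Algebra.EssFiniteType F (IntermediateField.adjoin F ({x} : Set K)) :=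
    (IntermediateField.essFiniteType_iff).2 (IntermediateField.fg_adjoin_of_finite (Set.finite_singleton x))
  have e2 : Algebra.EssFiniteType F K :=
    .comp F (IntermediateField.adjoin F ({x} : Set K)) K
  have e3 : Algebra.EssFiniteType (IntermediateField.adjoin F ({h} : Set K)) K :=
    .of_comp F _ K
  have alg : Algebra.IsAlgebraic (Algebra.adjoin F ({x} : Set K)) K :=
    (IsFractionRing.comap_isAlgebraic_iff (K := IntermediateField.adjoin F ({x} : Set K))).2
      inferInstance
  have tr : Algebra.trdeg F K ≤ 1 := by
    simpa using Algebra.IsAlgebraic.trdeg_le_cardinalMk F ({x} : Set K)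
  have hb : IsTranscendenceBasis F (fun _ : Unit => h) := by
    refine AlgebraicIndependent.isTranscendenceBasis_of_lift_trdeg_le_of_finite
      (algebraicIndependent_unique_type_iff.2 hh) ?_
    simpa using tr
  have := hb.isAlgebraic_field
  rw [Set.range_const] at this
  exact Algebra.finite_of_essFiniteType_of_isAlgebraic

theorem IsCurveFunctionField.exists_bound (hK : IsCurveFunctionField F K) {h : K}
    (hh : Transcendental F h) :
    ∃ N : ℕ, ∀ {ι : Type} [Fintype ι] (w : ι → K),
      LinearIndependent (Algebra.adjoin F ({h} : Set K)) w → Fintype.card ι ≤ N := by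
  have := hK.finiteDimensional_adjoin hh
  refine ⟨Module.finrank (IntermediateField.adjoin F ({h} : Set K)) K, fun w hw => ?_⟩
  exact ((LinearIndependent.iff_fractionRing (Algebra.adjoin F ({h} : Set K))
    (IntermediateField.adjoin F ({h} : Set K))).1 hw).fintype_card_le_finrank

/-! ### Discreteness of valuation rings and existence of poles -/

theorem ValuationSubring.valuation_algebraMap_eq_one (B : ValuationSubring K)
    (hF : ∀ a : F, algebraMap F K a ∈ B) {a : F} (ha : a ≠ 0) :
    B.valuation (algebraMap F K a) = 1 := by
  refine le_antisymm ((B.valuation_le_one_iff _).2 (hF a)) ?_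
  have h := (B.valuation_le_one_iff _).2 (hF a⁻¹)
  rw [map_inv₀, map_inv₀] at h
  have hne : B.valuation (algebraMap F K a) ≠ 0 := by
    simpa using ha
  exact (inv_le_one₀ (zero_lt_iff.2 hne)).1 h

theorem IsCurveFunctionField.transcendental_of_valuation_lt_one (hK : IsCurveFunctionField F K)
    (B : ValuationSubring K) (hF : ∀ a : F, algebraMap F K a ∈ B) {h : K} (h0 : h ≠ 0)
    (hh : B.valuation h < 1) : Transcendental F h := by
  intro halg
  obtain ⟨a, rfl⟩ := hK.full_constants h halg
  have ha : a ≠ 0 := by rintro rfl; simp at h0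
  exact hh.ne (B.valuation_algebraMap_eq_one hF ha)

theorem ValuationSubring.valuation_aeval_le_one (B : ValuationSubring K)
    (hF : ∀ a : F, algebraMap F K a ∈ B) {h : K} (hh : h ∈ B) (p : F[X]) :
    B.valuation (aeval h p) ≤ 1 := by
  rw [B.valuation_le_one_iff, aeval_eq_sum_range]
  refine sum_mem fun i _ => ?_
  rw [Algebra.smul_def]
  exact B.mul_mem _ _ (hF _) (pow_mem hh i)

theorem ValuationSubring.valuation_aeval_le (B : ValuationSubring K)
    (hF : ∀ a : F, algebraMap F K a ∈ B) {h : K} (hh : h ∈ B) {p : F[X]} (hp : p.coeff 0 = 0) :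
    B.valuation (aeval h p) ≤ B.valuation h := by
  obtain ⟨q, rfl⟩ := X_dvd_iff.2 hp
  rw [map_mul, aeval_X, map_mul]
  exact mul_le_of_le_one_right' (B.valuation_aeval_le_one hF hh q)

theorem ValuationSubring.valuation_aeval_eq_one (B : ValuationSubring K)
    (hF : ∀ a : F, algebraMap F K a ∈ B) {h : K} (hh : B.valuation h < 1) {p : F[X]}
    (hp : p.coeff 0 ≠ 0) : B.valuation (aeval h p) = 1 := by
  have hmem : h ∈ B := (B.valuation_le_one_iff _).1 hh.le
  have e : aeval h p = aeval h (p - C (p.coeff 0)) + algebraMap F K (p.coeff 0) := by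
    rw [map_sub, aeval_C, sub_add_cancel]
  have h1 := B.valuation_algebraMap_eq_one hF hp
  rw [e, Valuation.map_add_eq_of_lt_right _ ?_, h1]
  rw [h1]
  exact (B.valuation_aeval_le hF hmem (by simp)).trans_lt hh

theorem ValuationSubring.linearIndependent_of_strictMono (B : ValuationSubring K)
    (hF : ∀ a : F, algebraMap F K a ∈ B) (y : ℕ → K) (hy0 : y 0 ≠ 0)
    (hy : StrictMono fun i => B.valuation (y i)) (hy1 : ∀ i, B.valuation (y i) < 1) (n : ℕ) :
    LinearIndependent (Algebra.adjoin F ({y 0} : Set K)) fun i : Fin n => y i := by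
  have hmem : y 0 ∈ B := (B.valuation_le_one_iff _).1 (hy1 0).le
  have hpos : ∀ i, 0 < B.valuation (y i) := fun i =>
    (zero_lt_iff.2 ((Valuation.ne_zero_iff _).2 hy0)).trans_le (hy.monotone (Nat.zero_le i))
  refine linearIndependent_adjoin_of_coeff_zero hy0 _ fun p hp => ?_
  rw [finsum_eq_sum_of_fintype] at hp
  by_contra! hex
  classical
  -- The term at the largest such `j` strictly dominates: earlier `y i` have smaller valuation, and
  -- later terms carry a factor `y 0`, which puts them below `y 0` itself. So the sum cannot be
  -- zero.
  obtain ⟨j, hj, hmax⟩ := (Finset.univ.filter fun i => (p i).coeff 0 ≠ 0).exists_max_image id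
    (hex.imp fun i hi => by simpa using hi)
  simp only [Finset.mem_filter, Finset.mem_univ, true_and, id] at hj hmax
  have hvj : B.valuation (aeval (y 0) (p j) * y j) = B.valuation (y j) := by
    rw [map_mul, B.valuation_aeval_eq_one hF (hy1 0) hj, one_mul]
  have := B.valuation.map_sum_eq_of_lt (f := fun i => aeval (y 0) (p i) * y i)
    (Finset.mem_univ j) fun i hi => by
      simp only [Finset.mem_sdiff, Finset.mem_univ, Finset.mem_singleton, true_and] at hi
      rw [hvj, map_mul]
      rcases lt_or_gt_of_ne hi with hlt | hgt
      · exact (mul_le_of_le_one_left' (B.valuation_aeval_le_one hF hmem _)).trans_lt (hy hlt)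
      · have hc : (p i).coeff 0 = 0 := by
          by_contra hc
          exact absurd (hmax i hc) (not_le.2 hgt)
        calc _ ≤ B.valuation (y 0) * B.valuation (y i) :=
              mul_le_mul_left (B.valuation_aeval_le hF hmem hc) _
          _ < B.valuation (y 0) * 1 := by
              exact mul_lt_mul_of_pos_left (hy1 i) (hpos 0)
          _ = B.valuation (y 0) := mul_one _
          _ ≤ _ := hy.monotone (Nat.zero_le _)
  rw [hp, map_zero, hvj] at this
  exact (hpos j).ne this

/-- Every nontrivial valuation ring of a function field over its constants is discrete. -/
theorem IsCurveFunctionField.isDiscreteValuationRing (hK : IsCurveFunctionField F K)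
    (B : ValuationSubring K) (hF : ∀ a : F, algebraMap F K a ∈ B) {z : K} (hz : z ∉ B) :
    IsDiscreteValuationRing B := by
  have hwf : WfDvdMonoid B := by
    refine ⟨?_⟩
    rw [wellFounded_iff_isEmpty_descending_chain]
    refine ⟨fun ⟨f, hf⟩ => ?_⟩
    have hlt : ∀ n, f (n + 1) ≠ 0 ∧ B.valuation (f n : K) < B.valuation (f (n + 1) : K) := by
      intro n
      obtain ⟨h0, c, hc, e⟩ := hf n
      refine ⟨h0, ?_⟩
      have h0' : (f (n + 1) : K) ≠ 0 := fun h => h0 (Subtype.ext h)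
      have hc1 : B.valuation (c : K) < 1 := (B.valuation_lt_one_iff c).1 hc
      rw [e, MulMemClass.coe_mul, map_mul]
      exact mul_lt_of_lt_one_right (zero_lt_iff.2 ((Valuation.ne_zero_iff _).2 h0')) hc1
    -- The chain is used from index 1 because `f 0` may be zero.
    have h10 : (f 1 : K) ≠ 0 := fun h => (hlt 0).1 (Subtype.ext h)
    have hy1 : ∀ i, B.valuation (f (i + 1) : K) < 1 := fun i =>
      (hlt (i + 1)).2.trans_le (B.valuation_le_one _)
    obtain ⟨N, hN⟩ := hK.exists_bound
      (hK.transcendental_of_valuation_lt_one B hF h10 (hy1 0))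
    have := hN _ (B.linearIndependent_of_strictMono hF (fun i => (f (i + 1) : K)) h10
      (strictMono_nat_of_lt_succ fun i => (hlt (i + 1)).2) hy1 (N + 1))
    simp at this
  have hpir : IsPrincipalIdealRing B := ((IsBezout.TFAE (R := B)).out 1 3).2 hwf
  refine { hpir with not_a_field' := fun hbot => ?_ }
  have hinv : z⁻¹ ∈ B := (B.mem_or_inv_mem z).resolve_left hz
  have hm : (⟨z⁻¹, hinv⟩ : B) ∈ IsLocalRing.maximalIdeal B := by
    rw [B.valuation_lt_one_iff]
    have := mt (B.valuation_le_one_iff z).1 hz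
    have hz0 : z ≠ 0 := by rintro rfl; exact hz B.zero_mem
    rw [map_inv₀]
    exact inv_lt_one_of_one_lt₀ (not_le.1 this)
  rw [hbot] at hm
  have : z⁻¹ = 0 := congrArg Subtype.val ((Submodule.mem_bot _).1 hm)
  rw [inv_eq_zero] at this
  exact hz (this ▸ B.zero_mem)

/-- A nonconstant function has a pole. -/
theorem IsCurveFunctionField.exists_place_notMem (hK : IsCurveFunctionField F K) {f : K}
    (hf : f ∉ (algebraMap F K).range) : ∃ Q : Place F K, f ∉ Q.ring := by
  -- Full constants make `F` integrally closed in `K`, hence an intersection of valuation rings; one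
  -- of them omits `f`.
  have hic : IsIntegrallyClosedIn (⊥ : Subalgebra F K).toSubring K := by
    rw [Subring.isIntegrallyClosedIn_iff]
    intro x hx
    have hx' : IsIntegral F x := isIntegral_trans (A := (⊥ : Subalgebra F K)) x hx
    obtain ⟨a, rfl⟩ := hK.full_constants x hx'.isAlgebraic
    exact Subalgebra.algebraMap_mem _ a
  have hf' : f ∉ (⊥ : Subalgebra F K).toSubring := fun h => hf (by
    obtain ⟨a, ha⟩ := Algebra.mem_bot.1 (show f ∈ (⊥ : Subalgebra F K) from h)
    exact ⟨a, ha⟩)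
  obtain ⟨B, hB, hfB⟩ := Subring.exists_le_valuationSubring_of_isIntegrallyClosedIn hf'
  have hF : ∀ a : F, algebraMap F K a ∈ B := fun a => hB (Subalgebra.algebraMap_mem _ a)
  exact ⟨⟨B, hF, hK.isDiscreteValuationRing B hF hfB⟩, hfB⟩

/-! ### Residues and values at places -/

namespace Place

variable (P : Place F K)

theorem valuation_le_one_iff {f : K} : P.valuation f ≤ 1 ↔ f ∈ P.ring := by
  constructor
  · intro h
    obtain ⟨a, rfl⟩ := IsDiscreteValuationRing.exists_lift_of_le_one h
    exact a.2
  · intro h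
    exact (IsDiscreteValuationRing.maximalIdeal P.ring).valuation_le_one (K := K) ⟨f, h⟩

theorem valuation_lt_one_iff (f : P.ring) :
    P.valuation (f : K) < 1 ↔ IsLocalRing.residue P.ring f = 0 := by
  rw [IsLocalRing.residue_eq_zero_iff]
  exact (IsDiscreteValuationRing.maximalIdeal P.ring).valuation_lt_one_iff_mem (K := K) f

theorem hasValue_zero_iff {f : K} : P.HasValue f 0 ↔ P.valuation f < 1 := by
  constructor
  · rintro ⟨hf, e⟩
    exact (P.valuation_lt_one_iff ⟨f, hf⟩).2 (by rw [e, map_zero])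
  · intro h
    have hf := P.valuation_le_one_iff.1 h.le
    exact ⟨hf, by rw [(P.valuation_lt_one_iff ⟨f, hf⟩).1 h, map_zero]⟩

theorem exists_valuation_eq_exp : ∃ t : K, P.valuation t = WithZero.exp (-1 : ℤ) :=
  (IsDiscreteValuationRing.maximalIdeal P.ring).valuation_exists_uniformizer K

theorem valuation_ring_lt_one_iff {f : K} : P.ring.valuation f < 1 ↔ P.valuation f < 1 := by
  constructor
  · intro h
    have hf := (P.ring.valuation_le_one_iff _).1 h.le
    rw [P.valuation_lt_one_iff ⟨f, hf⟩, IsLocalRing.residue_eq_zero_iff,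
      P.ring.valuation_lt_one_iff]
    exact h
  · intro h
    have hf := P.valuation_le_one_iff.1 h.le
    rw [P.valuation_lt_one_iff ⟨f, hf⟩, IsLocalRing.residue_eq_zero_iff,
      P.ring.valuation_lt_one_iff] at h
    exact h

/-- The valuation ring of a place as an algebra over the constants. -/
def subalgebra : Subalgebra F K :=
  { P.ring.toSubring with algebraMap_mem' := P.algebraMap_mem }

/-- The residue map of a place. -/
noncomputable def residueMap : P.subalgebra →ₐ[F] P.Residue where
  toFun f := IsLocalRing.residue P.ring ⟨f, f.2⟩
  map_one' := map_one (IsLocalRing.residue P.ring)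
  map_mul' f g := map_mul (IsLocalRing.residue P.ring) ⟨f, f.2⟩ ⟨g, g.2⟩
  map_zero' := map_zero (IsLocalRing.residue P.ring)
  map_add' f g := map_add (IsLocalRing.residue P.ring) ⟨f, f.2⟩ ⟨g, g.2⟩
  commutes' _ := rfl

theorem residueMap_surjective : Function.Surjective P.residueMap := fun y => by
  obtain ⟨f, rfl⟩ := IsLocalRing.residue_surjective y
  exact ⟨⟨f, f.2⟩, rfl⟩

theorem residueMap_eq_zero_iff (f : P.subalgebra) :
    P.residueMap f = 0 ↔ P.valuation (f : K) < 1 :=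
  (P.valuation_lt_one_iff ⟨f, f.2⟩).symm

/-- Lifts of independent residues are independent over `F[t]` for a uniformizer `t`, so their number
is bounded by the degree of `K` over `F(t)`. -/
theorem finite_residue (hK : IsCurveFunctionField F K) : Module.Finite F P.Residue := by
  obtain ⟨t, ht⟩ := P.exists_valuation_eq_exp
  have ht0 : t ≠ 0 := by
    rintro rfl
    rw [map_zero] at ht
    exact WithZero.exp_ne_zero ht.symm
  have ht1 : P.valuation t < 1 := by
    rw [ht, ← WithZero.exp_zero, WithZero.exp_lt_exp]
    norm_num
  have htP : t ∈ P.subalgebra := P.valuation_le_one_iff.1 ht1.le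
  obtain ⟨N, hN⟩ := hK.exists_bound (hK.transcendental_of_valuation_lt_one P.ring P.algebraMap_mem
    ht0 (P.valuation_ring_lt_one_iff.2 ht1))
  have hrank : Module.rank F P.Residue ≤ N := by
    refine rank_le fun s hs => ?_
    choose w hw using fun y : P.Residue => P.residueMap_surjective y
    let e := s.equivFin
    have hs' : LinearIndependent F fun i : Fin s.card => P.residueMap (w (e.symm i)) := by
      simp only [hw]
      exact hs.comp _ e.symm.injective
    have := hN _ (linearIndependent_adjoin_of_residue ht0 P.subalgebra htP P.residueMap.toLinearMap
      (fun r => by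
        rw [AlgHom.toLinearMap_apply, map_mul, (P.residueMap_eq_zero_iff ⟨t, htP⟩).2 ht1, zero_mul])
      (fun i => w (e.symm i)) hs')
    simpa using this
  exact Module.rank_lt_aleph0_iff.1 (hrank.trans_lt Cardinal.natCast_lt_aleph0)

theorem exists_hasValue (hdeg : P.degree = 1) {f : K} (hf : f ∈ P.ring) : ∃ a, P.HasValue f a := by
  obtain ⟨a, ha⟩ := (finrank_eq_one_iff_of_nonzero' (1 : P.Residue) one_ne_zero).1 hdeg
    (P.residueMap ⟨f, hf⟩)
  exact ⟨a, hf, by rw [Algebra.algebraMap_eq_smul_one, ha]; rfl⟩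

theorem HasValue.const (a : F) : P.HasValue (algebraMap F K a) a :=
  ⟨P.algebraMap_mem a, rfl⟩

variable {P}

theorem HasValue.mul {f g : K} {a b : F} (hf : P.HasValue f a) (hg : P.HasValue g b) :
    P.HasValue (f * g) (a * b) := by
  obtain ⟨h1, e1⟩ := hf
  obtain ⟨h2, e2⟩ := hg
  refine ⟨P.ring.mul_mem _ _ h1 h2, ?_⟩
  rw [map_mul, ← e1, ← e2, ← map_mul]
  rfl

theorem HasValue.aeval {f : K} {a : F} (hf : P.HasValue f a) (p : F[X]) :
    P.HasValue (aeval f p) (p.eval a) := by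
  induction p using Polynomial.induction_on' with
  | add p q hp hq => simpa using hp.add P hq
  | monomial n c =>
    have : ∀ n : ℕ, P.HasValue (f ^ n) (a ^ n) := fun n => by
      induction n with
      | zero => simpa using HasValue.const P 1
      | succ n ih => rw [pow_succ, pow_succ]; exact ih.mul hf
    rw [aeval_monomial, eval_monomial, ← Algebra.smul_def]
    exact (this n).smul P c

theorem HasValue.inv {f : K} {a : F} (hf : P.HasValue f a) (ha : a ≠ 0) :
    P.HasValue f⁻¹ a⁻¹ := by
  obtain ⟨h1, e1⟩ := hf
  have hr : P.residueMap ⟨f, h1⟩ ≠ 0 := by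
    intro h
    have h' : algebraMap F P.Residue a = 0 := e1.symm.trans h
    exact ha (by simpa using h')
  have hv : P.valuation f = 1 := by
    refine le_antisymm (P.valuation_le_one_iff.2 h1) (not_lt.1 fun h => hr ?_)
    exact (P.residueMap_eq_zero_iff ⟨f, h1⟩).2 h
  have h2 : f⁻¹ ∈ P.subalgebra := P.valuation_le_one_iff.1 (by rw [map_inv₀, hv, inv_one])
  have hf0 : f ≠ 0 := by rintro rfl; simp at hv
  refine ⟨h2, mul_left_cancel₀ hr ?_⟩
  have e2 : P.residueMap ⟨f, h1⟩ * P.residueMap ⟨f⁻¹, h2⟩ = 1 := by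
    rw [← map_mul, ← map_one P.residueMap]
    exact congrArg _ (Subtype.ext (mul_inv_cancel₀ hf0))
  have e3 : P.residueMap ⟨f, h1⟩ * algebraMap F P.Residue a⁻¹ = 1 := by
    have : P.residueMap ⟨f, h1⟩ = algebraMap F P.Residue a := e1
    rw [this, ← map_mul, mul_inv_cancel₀ ha, map_one]
  exact e2.trans e3.symm

theorem HasValue.unique {f : K} {a b : F} (ha : P.HasValue f a) (hb : P.HasValue f b) : a = b := by
  obtain ⟨_, e1⟩ := ha
  obtain ⟨_, e2⟩ := hb
  exact (algebraMap F P.Residue).injective (e1.symm.trans e2)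

/-! ### Separation of distinct places -/

theorem ext_ring {Q : Place F K} (h : P.ring = Q.ring) : P = Q := by
  cases P; cases Q; cases h; rfl

theorem exists_mem_notMem {Q : Place F K} (h : P ≠ Q) : ∃ f, f ∈ P.ring ∧ f ∉ Q.ring := by
  by_contra! hle
  have hle' : P.ring ≤ Q.ring := hle
  rcases ValuationSubring.eq_self_or_eq_top_of_le hle' with h1 | h1
  · exact h (ext_ring h1)
  · obtain ⟨t, ht⟩ := Q.exists_valuation_eq_exp
    have : t⁻¹ ∈ Q.ring := h1 ▸ ValuationSubring.mem_top _
    rw [← Q.valuation_le_one_iff, map_inv₀, ht, ← WithZero.exp_neg, ← WithZero.exp_zero,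
      WithZero.exp_le_exp] at this
    norm_num at this

/-- Two distinct places are separated by a function with a zero at one and a pole at the other. -/
theorem exists_zero_pole {P Q : Place F K} (h : P ≠ Q) :
    ∃ z : K, P.valuation z < 1 ∧ 1 < Q.valuation z := by
  obtain ⟨a, haP, haQ⟩ := exists_mem_notMem h
  obtain ⟨b, hbQ, hbP⟩ := exists_mem_notMem h.symm
  rw [← valuation_le_one_iff] at haP haQ hbP hbQ
  rw [not_le] at haQ hbP
  refine ⟨a / b, ?_, ?_⟩
  · rw [map_div₀, div_lt_one₀ (zero_lt_one.trans hbP)]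
    exact haP.trans_lt hbP
  · have hb0 : b ≠ 0 := by rintro rfl; simp at hbP
    rw [map_div₀, one_lt_div₀ (zero_lt_iff.2 ((Valuation.ne_zero_iff _).2 hb0))]
    exact hbQ.trans_lt haQ

/-- The function `1 / (z ^ q - z + 1)` is regular at all rational places, with value `0` at the
poles of `z` and `1` elsewhere. -/
theorem exists_separating [Finite F] {P Q : Place F K} (h : P ≠ Q) :
    ∃ w : K, P.HasValue w 1 ∧ Q.HasValue w 0 ∧ ∀ R : Place F K, R.degree = 1 → w ∈ R.ring := by
  obtain ⟨z, hzP, hzQ⟩ := exists_zero_pole h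
  cases nonempty_fintype F
  set q := Fintype.card F with hq
  have hq1 : 1 < q := Fintype.one_lt_card
  have hreg : ∀ (R : Place F K) (a : F), R.HasValue z a → R.HasValue (z ^ q - z + 1)⁻¹ 1 := by
    intro R a ha
    -- Every `a` in `F` satisfies `a ^ q = a`, so the denominator has value 1.
    have := ha.aeval (X ^ q - X + 1 : F[X])
    simp only [map_add, map_sub, map_pow, aeval_X, map_one, eval_add, eval_sub, eval_pow, eval_X,
      eval_one, hq, FiniteField.pow_card, sub_self, zero_add] at this
    simpa using this.inv one_ne_zero
  have hpole : ∀ R : Place F K, 1 < R.valuation z → R.HasValue (z ^ q - z + 1)⁻¹ 0 := by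
    intro R hR
    have h1 : R.valuation z < R.valuation (z ^ q) := by
      rw [map_pow]
      exact lt_self_pow₀ hR hq1
    have h2 : R.valuation (z ^ q - z) = R.valuation (z ^ q) :=
      Valuation.map_sub_eq_of_lt_left _ h1
    have h3 : R.valuation (z ^ q - z + 1) = R.valuation (z ^ q) := by
      rw [Valuation.map_add_eq_of_lt_left, h2]
      rw [h2, map_one]
      exact hR.trans h1
    rw [hasValue_zero_iff, map_inv₀, h3]
    exact inv_lt_one_of_one_lt₀ (hR.trans h1)
  refine ⟨(z ^ q - z + 1)⁻¹, hreg P 0 (P.hasValue_zero_iff.2 hzP), hpole Q hzQ, fun R hR => ?_⟩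
  by_cases hz : z ∈ R.ring
  · obtain ⟨a, ha⟩ := R.exists_hasValue hR hz
    exact (hreg R a ha).1
  · rw [← valuation_le_one_iff, not_le] at hz
    exact (hpole R hz).1

theorem exists_separating_family [Finite F] {n : ℕ} (P : Fin n → Place F K)
    (hP : Function.Injective P) (hdeg : ∀ i, (P i).degree = 1) (i : Fin n) :
    ∃ w : K, ∀ j, (P j).HasValue w (if j = i then 1 else 0) := by
  have : ∀ j, ∃ w : K, (P i).HasValue w 1 ∧ (j ≠ i → (P j).HasValue w 0) ∧
      ∀ l, w ∈ (P l).ring := fun j => by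
    by_cases h : j = i
    · refine ⟨1, ?_, fun h' => absurd h h', fun l => (P l).ring.one_mem⟩
      simpa using HasValue.const (P i) 1
    · obtain ⟨w, h1, h2, h3⟩ := exists_separating (fun e => h (hP e).symm : P i ≠ P j)
      exact ⟨w, h1, fun _ => h2, fun l => h3 _ (hdeg l)⟩
  choose w h1 h2 h3 using this
  -- At `P j` with `j ≠ i` the factor `w j` vanishes and the others are regular; at `P i` every
  -- factor has value 1.
  refine ⟨∏ j, w j, fun j => ?_⟩
  split_ifs with h
  · subst h
    refine Finset.prod_induction w (fun f => (P j).HasValue f 1)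
      (fun f g hf hg => by simpa using hf.mul hg) (by simpa using HasValue.const (P j) 1)
      fun l _ => h1 l
  · rw [hasValue_zero_iff, map_prod, ← Finset.mul_prod_erase _ _ (Finset.mem_univ j)]
    refine mul_lt_one_of_lt_of_le ((P j).hasValue_zero_iff.1 (h2 j h)) ?_
    exact Finset.prod_le_one' fun l _ => (P j).valuation_le_one_iff.2 (h3 l j)

end Place

/-! ### Dimension of Riemann-Roch spaces -/

theorem mem_riemannRochSpace_iff {D : FFDivisor F K} {f : K} :
    f ∈ riemannRochSpace D ↔ ∀ P : Place F K, P.valuation f ≤ WithZero.exp (D P) := by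
  change (f = 0 ∨ ∀ P : Place F K, -D P ≤ P.ord f) ↔ _
  rcases eq_or_ne f 0 with rfl | hf
  · simp
  · simp only [hf, false_or]
    exact forall_congr' fun P => P.neg_le_ord_iff hf _

namespace FFDivisor

theorem deg_zero : (0 : FFDivisor F K).deg = 0 := Finsupp.sum_zero_index

theorem deg_single (Q : Place F K) (m : ℤ) :
    FFDivisor.deg (Finsupp.single Q m) = m * Q.degree :=
  Finsupp.sum_single_index (by simp)

theorem deg_add (D E : FFDivisor F K) : (D + E).deg = D.deg + E.deg :=
  Finsupp.sum_add_index' (by simp) fun _ _ _ => add_mul _ _ _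

theorem deg_zsmul (c : ℤ) (D : FFDivisor F K) : FFDivisor.deg (c • D) = c * D.deg := by
  unfold FFDivisor.deg
  rw [Finsupp.sum_smul_index (by simp), Finsupp.mul_sum]
  simp only [mul_assoc]

theorem deg_nonneg {D : FFDivisor F K} (hD : 0 ≤ D) : 0 ≤ D.deg :=
  Finset.sum_nonneg fun P _ => mul_nonneg (hD P) (Int.natCast_nonneg _)

end FFDivisor

theorem rank_riemannRochSpace_zero (hK : IsCurveFunctionField F K) :
    Module.rank F (riemannRochSpace (0 : FFDivisor F K)) ≤ 1 := by
  have hle : riemannRochSpace (0 : FFDivisor F K) ≤ Submodule.span F {1} := by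
    intro f hf
    by_contra hne
    have hnc : f ∉ (algebraMap F K).range := by
      rintro ⟨a, rfl⟩
      exact hne (Submodule.mem_span_singleton.2 ⟨a, (Algebra.algebraMap_eq_smul_one a).symm⟩)
    obtain ⟨Q, hQ⟩ := hK.exists_place_notMem hnc
    exact hQ (Q.valuation_le_one_iff.1 (mem_riemannRochSpace_iff.1 hf Q))
  refine (Submodule.rank_mono hle).trans ((rank_span_le _).trans ?_)
  simp

/-- The leading coefficient at `Q`, the residue of `f * t ^ (D Q + 1)`, is a linear map into the
residue field whose kernel lies in `L(D)`. -/
theorem rank_riemannRochSpace_add_single_le (hK : IsCurveFunctionField F K) (D : FFDivisor F K)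
    (Q : Place F K) :
    Module.rank F (riemannRochSpace (D + Finsupp.single Q 1)) ≤
      Q.degree + Module.rank F (riemannRochSpace D) := by
  classical
  have := Q.finite_residue hK
  obtain ⟨t, ht⟩ := Q.exists_valuation_eq_exp
  set m : ℤ := D Q + 1 with hm
  have htm : Q.valuation (t ^ m) = WithZero.exp (-m) := by
    rw [map_zpow₀, ht, ← WithZero.exp_zsmul]
    simp
  have hmul : ∀ f : K, ∀ k : ℤ,
      Q.valuation (f * t ^ m) ≤ WithZero.exp (k - m) ↔ Q.valuation f ≤ WithZero.exp k := by
    intro f k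
    rw [map_mul, htm, sub_eq_add_neg, WithZero.exp_add]
    exact mul_le_mul_iff_left₀ (WithZero.exp_pos)
  have hmem : ∀ f ∈ riemannRochSpace (D + Finsupp.single Q 1), f * t ^ m ∈ Q.subalgebra := by
    intro f hf
    refine Q.valuation_le_one_iff.1 ?_
    have := (hmul f m).2 (by simpa [hm] using mem_riemannRochSpace_iff.1 hf Q)
    rwa [sub_self, WithZero.exp_zero] at this
  let ψ : riemannRochSpace (D + Finsupp.single Q 1) →ₗ[F] Q.Residue :=
    Q.residueMap.toLinearMap ∘ₗ
      (((LinearMap.mulRight F (t ^ m)) ∘ₗ (Submodule.subtype _)).codRestrict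
        (Subalgebra.toSubmodule Q.subalgebra) fun f => hmem f f.2)
  have hker : ∀ f : LinearMap.ker ψ, (f : K) ∈ riemannRochSpace D := by
    intro f
    have h0 : Q.residueMap ⟨(f : K) * t ^ m, hmem f f.1.2⟩ = 0 := f.2
    rw [Q.residueMap_eq_zero_iff] at h0
    rw [mem_riemannRochSpace_iff]
    intro P
    by_cases hPQ : Q = P
    · subst hPQ
      rw [← hmul, hm, sub_add_cancel_left]
      -- By discreteness, a vanishing residue lowers the pole order by a full unit.
      rw [← WithZero.lt_mul_exp_iff_le WithZero.exp_ne_zero, ← WithZero.exp_add]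
      simpa using h0
    · have := mem_riemannRochSpace_iff.1 f.1.2 P
      simpa [Finsupp.single_eq_of_ne' hPQ] using this
  rw [← LinearMap.rank_range_add_rank_ker ψ]
  refine add_le_add ?_ ?_
  · rw [Place.degree, Module.finrank_eq_rank]
    exact Submodule.rank_le _
  · exact LinearMap.rank_le_of_injective
      (((Submodule.subtype _ ∘ₗ Submodule.subtype _).codRestrict _ hker))
      fun f g h => Subtype.ext (Subtype.ext (congrArg Subtype.val h :))

theorem rank_riemannRochSpace_le (hK : IsCurveFunctionField F K) (D : FFDivisor F K) (hD : 0 ≤ D) :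
    Module.rank F (riemannRochSpace D) ≤ ((D.deg.toNat + 1 : ℕ) : Cardinal) := by
  classical
  -- Induction on the sum of the coefficients instead of the degree avoids any appeal to positivity
  -- of place degrees.
  obtain ⟨N, hN⟩ : ∃ N : ℕ, (D.sum fun _ m => m) ≤ N := ⟨_, Int.self_le_toNat _⟩
  induction N generalizing D with
  | zero =>
    have : D = 0 := by
      ext Q
      by_contra hne
      have h1 : D Q ≤ D.sum fun _ m => m :=
        Finset.single_le_sum (f := fun Q => D Q) (fun P _ => hD P) (Finsupp.mem_support_iff.2 hne)
      exact hne (le_antisymm (h1.trans hN) (hD Q))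
    rw [this, FFDivisor.deg_zero]
    simpa using rank_riemannRochSpace_zero hK
  | succ N ih =>
    by_cases h0 : D = 0
    · rw [h0, FFDivisor.deg_zero]
      simpa using rank_riemannRochSpace_zero hK
    obtain ⟨Q, hQ⟩ := Finsupp.ne_iff.1 h0
    have hQ1 : 1 ≤ D Q := lt_of_le_of_ne (hD Q) (Ne.symm hQ)
    set E : FFDivisor F K := D - Finsupp.single Q 1 with hE
    have hDE : D = E + Finsupp.single Q 1 := (sub_add_cancel _ _).symm
    have hE0 : 0 ≤ E := by
      intro P
      by_cases hPQ : Q = P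
      · subst hPQ
        simpa [hE] using hQ1
      · simpa [hE, Finsupp.single_eq_of_ne' hPQ] using hD P
    have hEN : (E.sum fun _ m => m) ≤ N := by
      rw [hE, Finsupp.sum_sub_index fun _ _ _ => rfl, Finsupp.sum_single_index rfl]
      push_cast at hN
      linarith
    have hdeg : D.deg.toNat + 1 = Q.degree + (E.deg.toNat + 1) := by
      rw [hDE, FFDivisor.deg_add, FFDivisor.deg_single]
      have := FFDivisor.deg_nonneg hE0
      omega
    rw [hdeg, Nat.cast_add, hDE]
    exact (rank_riemannRochSpace_add_single_le hK E Q).trans (by gcongr; exact ih E hE0 hEN)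

theorem card_le_deg_add_one (hK : IsCurveFunctionField F K) {D : FFDivisor F K} (hD : 0 ≤ D)
    {ι : Type*} [Fintype ι] {v : ι → K} (hv : LinearIndependent F v)
    (hmem : ∀ i, v i ∈ riemannRochSpace D) : (Fintype.card ι : ℤ) ≤ D.deg + 1 := by
  have hr := rank_riemannRochSpace_le hK D hD
  have : Module.Finite F (riemannRochSpace D) :=
    Module.rank_lt_aleph0_iff.1 (hr.trans_lt Cardinal.natCast_lt_aleph0)
  have hv' : LinearIndependent F fun i => (⟨v i, hmem i⟩ : riemannRochSpace D) :=
    LinearIndependent.of_comp (Submodule.subtype _) hv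
  have := hv'.fintype_card_le_finrank.trans (Module.finrank_le_of_rank_le hr)
  have := FFDivisor.deg_nonneg hD
  omega

/-! ### Zeros are bounded by the degree of the poles -/

theorem Place.mem_ring_of_isIntegral_adjoin (Q : Place F K) {h w : K} (hh : h ∈ Q.ring)
    (hw : IsIntegral (Algebra.adjoin F ({h} : Set K)) w) : w ∈ Q.ring := by
  have hle : Algebra.adjoin F ({h} : Set K) ≤ Q.subalgebra :=
    Algebra.adjoin_le (Set.singleton_subset_iff.2 hh)
  have : IsIntegrallyClosedIn Q.ring.toSubring K := inferInstanceAs (IsIntegrallyClosedIn Q.ring K)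
  exact (Subring.integralClosure_subring_le_iff (S := Algebra.adjoin F ({h} : Set K))
    (T := Q.ring.toSubring)).2 hle hw

/-- If `w₁, …, wₙ` are linearly independent over `F[h]`, then the degree of any effective divisor
bounding the poles of `h` is at least `n`. -/
theorem card_le_deg_of_linearIndependent (hK : IsCurveFunctionField F K) {h : K}
    (hh : Transcendental F h) {A : FFDivisor F K} (hA : 0 ≤ A) (hhA : h ∈ riemannRochSpace A)
    {n : ℕ} (w : Fin n → K) (hw : LinearIndependent (Algebra.adjoin F ({h} : Set K)) w) :
    (n : ℤ) ≤ A.deg := by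
  classical
  have := hK.finiteDimensional_adjoin hh
  have alg : Algebra.IsAlgebraic (Algebra.adjoin F ({h} : Set K)) K :=
    (IsFractionRing.comap_isAlgebraic_iff (K := IntermediateField.adjoin F ({h} : Set K))).2
      inferInstance
  obtain ⟨a, ha, hint⟩ := Algebra.IsAlgebraic.exists_integral_multiples
    (Algebra.adjoin F ({h} : Set K)) (Finset.univ.image w)
  set u : Fin n → K := fun i => a • w i with hu
  have huint : ∀ i, IsIntegral (Algebra.adjoin F ({h} : Set K)) (u i) := fun i =>
    hint _ (Finset.mem_image_of_mem _ (Finset.mem_univ i))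
  have hulin : LinearIndependent (Algebra.adjoin F ({h} : Set K)) u := by
    refine hw.map' (LinearMap.lsmul (Algebra.adjoin F ({h} : Set K)) K a) ?_
    exact LinearMap.ker_eq_bot.2 (smul_right_injective K ha)
  -- Only places in the support of `A` need a bound: elsewhere `h` is regular, and so is `u i`,
  -- being integral over `F[h]`.
  obtain ⟨c, hc⟩ : ∃ c : ℕ, ∀ Q ∈ A.support, ∀ i, (Q.valuation (u i)).log ≤ c := by
    refine ⟨∑ Q ∈ A.support, ∑ i, (Q.valuation (u i)).log.toNat, fun Q hQ i => ?_⟩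
    refine (Int.self_le_toNat _).trans (Int.ofNat_le.2 ?_)
    exact (Finset.single_le_sum (f := fun i => (Q.valuation (u i)).log.toNat)
      (fun _ _ => Nat.zero_le _) (Finset.mem_univ i)).trans
      (Finset.single_le_sum (f := fun Q : Place F K => ∑ i, (Q.valuation (u i)).log.toNat)
        (fun _ _ => Nat.zero_le _) hQ)
  have hmem : ∀ (t j : ℕ) (i : Fin n), j ≤ t →
      h ^ j * u i ∈ riemannRochSpace (((t + c : ℕ) : ℤ) • A) := by
    intro t j i hj
    rw [mem_riemannRochSpace_iff]
    intro Q
    have hhQ := mem_riemannRochSpace_iff.1 hhA Q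
    rw [map_mul, map_pow, Finsupp.smul_apply, smul_eq_mul]
    by_cases hQ : Q ∈ A.support
    · have hA1 : 1 ≤ A Q := lt_of_le_of_ne (hA Q) (Ne.symm (Finsupp.mem_support_iff.1 hQ))
      have h1 : Q.valuation (u i) ≤ WithZero.exp (c : ℤ) :=
        WithZero.le_exp_log.trans (WithZero.exp_le_exp.2 (hc Q hQ i))
      refine (mul_le_mul' (pow_le_pow_left' hhQ j) h1).trans ?_
      rw [← WithZero.exp_nsmul, ← WithZero.exp_add, WithZero.exp_le_exp, nsmul_eq_mul]
      push_cast
      have hj' : (j : ℤ) ≤ t := by exact_mod_cast hj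
      nlinarith [Int.natCast_nonneg c]
    · rw [Finsupp.notMem_support_iff.1 hQ] at hhQ ⊢
      rw [WithZero.exp_zero] at hhQ
      rw [mul_zero, WithZero.exp_zero]
      exact mul_le_one' (pow_le_one' hhQ j) (Q.valuation_le_one_iff.2
        (Q.mem_ring_of_isIntegral_adjoin (Q.valuation_le_one_iff.1 hhQ) (huint i)))
  let g : Algebra.adjoin F ({h} : Set K) := ⟨h, Algebra.self_mem_adjoin_singleton F h⟩
  have hpow : LinearIndependent F fun j : ℕ => g ^ j := by
    refine LinearIndependent.of_comp (Algebra.adjoin F ({h} : Set K)).val.toLinearMap ?_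
    have := (basisMonomials F).linearIndependent.map' (aeval h).toLinearMap
      (LinearMap.ker_eq_bot.2 (transcendental_iff_injective.1 hh))
    have e : (Algebra.adjoin F ({h} : Set K)).val.toLinearMap ∘ (fun j : ℕ => g ^ j) =
        (aeval h).toLinearMap ∘ basisMonomials F := by
      ext j
      simp [g]
    rw [e]
    exact this
  have hbound : ∀ t : ℕ, ((t : ℤ) + 1) * n ≤ ((t : ℤ) + c) * A.deg + 1 := by
    intro t
    have hlin := linearIndependent_smul (hpow.comp (fun j : Fin (t + 1) => (j : ℕ))
      Fin.val_injective) hulin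
    have hD : 0 ≤ ((t + c : ℕ) : ℤ) • A := fun Q => mul_nonneg (Int.natCast_nonneg _) (hA Q)
    have := card_le_deg_add_one hK hD hlin fun p => hmem t p.1 p.2 (Nat.lt_succ_iff.1 p.1.2)
    rw [FFDivisor.deg_zsmul] at this
    simpa using this
  by_contra! hlt
  have hA0 := FFDivisor.deg_nonneg hA
  -- If `n ≥ deg A + 1`, the bound forces `t + deg A ≤ c * deg A`, which fails for this `t`.
  have := hbound (c * A.deg.toNat + 1)
  push_cast at this
  rw [Int.toNat_of_nonneg hA0] at this
  have h1 : (c * A.deg + 1 + 1) * (A.deg + 1) ≤ (c * A.deg + 1 + 1) * n :=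
    mul_le_mul_of_nonneg_left hlt (by positivity)
  linarith

/-- A nonzero function has at most as many rational zeros as the degree of any effective divisor
bounding its poles. -/
theorem card_zeros_le_deg [Finite F] (hK : IsCurveFunctionField F K) {n : ℕ} (hn : 0 < n)
    (P : Fin n → Place F K) (hP : Function.Injective P) (hdeg : ∀ i, (P i).degree = 1)
    {A : FFDivisor F K} (hA : 0 ≤ A) {h : K} (hhA : h ∈ riemannRochSpace A) (h0 : h ≠ 0)
    (hz : ∀ i, (P i).HasValue h 0) : (n : ℤ) ≤ A.deg := by
  have hh : Transcendental F h := hK.transcendental_of_valuation_lt_one (P ⟨0, hn⟩).ring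
    (P ⟨0, hn⟩).algebraMap_mem h0
    ((P ⟨0, hn⟩).valuation_ring_lt_one_iff.2 ((P ⟨0, hn⟩).hasValue_zero_iff.1 (hz _)))
  choose w hw using Place.exists_separating_family P hP hdeg
  let R : Subalgebra F K := ⨅ i, (P i).subalgebra
  have hR : ∀ {f}, f ∈ R ↔ ∀ i, f ∈ (P i).subalgebra := Algebra.mem_iInf
  have hwR : ∀ i, w i ∈ R := fun i => hR.2 fun j => (hw i j).1
  let φ : R →ₗ[F] ((i : Fin n) → (P i).Residue) := LinearMap.pi fun i =>
    (P i).residueMap.toLinearMap ∘ₗ (Subalgebra.inclusion (iInf_le _ i)).toLinearMap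
  have hφ : ∀ (f : R) i, φ f i = (P i).residueMap ⟨f, hR.1 f.2 i⟩ := fun _ _ => rfl
  refine card_le_deg_of_linearIndependent hK hh hA hhA w ?_
  refine linearIndependent_adjoin_of_residue h0 R (hR.2 fun i => (hz i).1) φ (fun r => ?_)
    (fun i => ⟨w i, hwR i⟩) ?_
  · funext i
    rw [hφ, Pi.zero_apply, (P i).residueMap_eq_zero_iff]
    change (P i).valuation (h * (r : K)) < 1
    rw [map_mul]
    exact mul_lt_one_of_lt_of_le ((P i).hasValue_zero_iff.1 (hz i))
      ((P i).valuation_le_one_iff.2 (hR.1 r.2 i))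
  · rw [Fintype.linearIndependent_iff]
    intro g hg j
    have hj := congrFun hg j
    -- The joint residues of the `w i` are the unit vectors.
    have hval : ∀ i, φ ⟨w i, hwR i⟩ j = algebraMap F (P j).Residue (if j = i then 1 else 0) :=
      fun i => (hw i j).2
    rw [Finset.sum_apply, Pi.zero_apply] at hj
    simp only [Pi.smul_apply, hval] at hj
    rw [Finset.sum_eq_single j (fun i _ hij => by simp [Ne.symm hij]) (by simp)] at hj
    simpa using hj

/-! ### The subfield subcode -/

theorem algebraMap_mem_riemannRochSpace {D : FFDivisor F K} (hD : 0 ≤ D) (a : F) :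
    algebraMap F K a ∈ riemannRochSpace D := by
  rw [mem_riemannRochSpace_iff]
  intro Q
  refine (Q.valuation_algebraMap_le_one a).trans ?_
  rw [← WithZero.exp_zero, WithZero.exp_le_exp]
  exact hD Q

theorem pow_sub_self_mem_riemannRochSpace {D : FFDivisor F K} (hD : 0 ≤ D) {f : K}
    (hf : f ∈ riemannRochSpace D) {r : ℕ} (hr : 0 < r) :
    f ^ r - f ∈ riemannRochSpace ((r : ℤ) • D) := by
  rw [mem_riemannRochSpace_iff] at hf ⊢
  intro Q
  rw [Finsupp.smul_apply, smul_eq_mul]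
  refine (Q.valuation.map_sub _ _).trans (max_le ?_ ?_)
  · rw [map_pow, ← nsmul_eq_mul, WithZero.exp_nsmul]
    exact pow_le_pow_left' (hf Q) r
  · refine (hf Q).trans (WithZero.exp_le_exp.2 ?_)
    have h0 : 0 ≤ D Q := hD Q
    have h1 : (1 : ℤ) ≤ r := by exact_mod_cast hr
    nlinarith

theorem IsCurveFunctionField.mem_range_of_pow_eq_self (hK : IsCurveFunctionField F K) {f : K}
    {r : ℕ} (hr : 1 < r) (hf : f ^ r = f) : f ∈ (algebraMap F K).range :=
  hK.full_constants f ⟨X ^ r - X, FiniteField.X_pow_card_sub_X_ne_zero F hr, by simp [hf]⟩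

theorem mem_subfieldSubcode_iff [Finite F] (hK : IsCurveFunctionField F K) (k : Subfield F)
    {n : ℕ} (hn : 0 < n) (P : Fin n → Place F K) (hP : Function.Injective P)
    (hdeg : ∀ i, (P i).degree = 1) {D : FFDivisor F K} (hD : 0 ≤ D)
    (hlt : (Nat.card k : ℤ) * D.deg < n) (c : Fin n → F) :
    c ∈ subfieldSubcode k (functionalCode P D) ↔ ∃ a ∈ k, c = fun _ => a := by
  constructor
  · rintro ⟨⟨f, hf, hfc⟩, hck⟩
    have hr : 1 < Nat.card k := Finite.one_lt_card
    have hpow : ∀ i, c i ^ Nat.card k = c i := fun i => by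
      cases nonempty_fintype k
      have := FiniteField.pow_card (⟨c i, hck i⟩ : k)
      rw [← Nat.card_eq_fintype_card] at this
      exact congrArg Subtype.val this
    have hz : ∀ i, (P i).HasValue (f ^ Nat.card k - f) 0 := fun i => by
      have h := (hfc i).aeval (X ^ Nat.card k - X : F[X])
      rwa [map_sub, map_pow, aeval_X, eval_sub, eval_pow, eval_X, hpow i, sub_self] at h
    have hfr : f ^ Nat.card k - f = 0 := by
      by_contra h0
      have := card_zeros_le_deg hK hn P hP hdeg
        (fun Q => mul_nonneg (Int.natCast_nonneg (Nat.card k)) (hD Q))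
        (pow_sub_self_mem_riemannRochSpace hD hf (zero_lt_one.trans hr)) h0 hz
      rw [FFDivisor.deg_zsmul] at this
      exact this.not_gt hlt
    obtain ⟨a, rfl⟩ := hK.mem_range_of_pow_eq_self hr (sub_eq_zero.1 hfr)
    have hca : ∀ i, c i = a := fun i => (hfc i).unique (.const (P i) a)
    exact ⟨a, hca ⟨0, hn⟩ ▸ hck ⟨0, hn⟩, funext hca⟩
  · rintro ⟨a, ha, rfl⟩
    exact ⟨⟨algebraMap F K a, algebraMap_mem_riemannRochSpace hD a, fun i => .const (P i) a⟩,
      fun _ => ha⟩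

theorem finrank_eq_one_of_forall_mem_iff_const {k : Subfield F} {n : ℕ} (hn : 0 < n)
    (S : Submodule k (Fin n → F)) (hS : ∀ c, c ∈ S ↔ ∃ a ∈ k, c = fun _ => a) :
    Module.finrank k S = 1 := by
  have h1 : (fun _ => 1 : Fin n → F) ∈ S := (hS _).2 ⟨1, k.one_mem, rfl⟩
  refine finrank_eq_one ⟨_, h1⟩ (fun h => ?_) fun w => ?_
  · exact one_ne_zero (congrFun (congrArg Subtype.val h) ⟨0, hn⟩ : (1 : F) = 0)
  · obtain ⟨a, ha, e⟩ := (hS _).1 w.2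
    refine ⟨⟨a, ha⟩, Subtype.ext ?_⟩
    rw [e]
    funext i
    exact mul_one a

end

/-- The bound on `x` is `x < n / (r * deg G)`, written without the division so that `G = 0`
(where it only says that `n` is positive) is covered as well. -/
theorem mainTheorem2 {F K : Type*} [Field F] [Finite F] [Field K] [Algebra F K]
    (hK : IsCurveFunctionField F K) (k : Subfield F)
    {n : ℕ} (P : Fin n → Place F K) (hP : Function.Injective P) (hdeg : ∀ i, (P i).degree = 1)
    (G : FFDivisor F K) (hG : 0 ≤ G) (hPG : ∀ i, P i ∉ G.support)
    (x : ℝ) (hx0 : 0 ≤ x) (hx : x * ((Nat.card k : ℝ) * (G.deg : ℝ)) < n) :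
    (∀ c : Fin n → F, c ∈ subfieldSubcode k (functionalCode P (⌊x⌋ • G)) ↔
      ∃ a ∈ k, c = fun _ => a) ∧
    extendedRate k P G x = 1 / (n : ℝ) := by
  have hdegG : (0 : ℝ) ≤ (G.deg : ℝ) := by exact_mod_cast FFDivisor.deg_nonneg hG
  -- The left side of `hx` is nonnegative, so the strict bound excludes `n = 0`.
  have hn : 0 < n := by
    have : (0 : ℝ) < n := lt_of_le_of_lt (by positivity) hx
    exact_mod_cast this
  have hD : 0 ≤ ⌊x⌋ • G := fun Q => mul_nonneg (Int.floor_nonneg.2 hx0) (hG Q)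
  have hlt : (Nat.card k : ℤ) * FFDivisor.deg (⌊x⌋ • G) < n := by
    rw [FFDivisor.deg_zsmul]
    have h : ((Nat.card k : ℝ)) * ((⌊x⌋ : ℝ) * (G.deg : ℝ)) < n := by
      refine lt_of_le_of_lt ?_ hx
      rw [mul_left_comm]
      exact mul_le_mul_of_nonneg_right (Int.floor_le x) (by positivity)
    exact_mod_cast h
  have hcode := mem_subfieldSubcode_iff hK k hn P hP hdeg hD hlt
  refine ⟨hcode, ?_⟩
  rw [extendedRate, subcodeRate, finrank_eq_one_of_forall_mem_iff_const hn _ hcode, Nat.cast_one]
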